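/- Let $d\ge 3$. A $d$-polytope is the convex hull of a nonempty finite set of points in some $\mathbb{R}^n$ whose affine hull has dimension $d$. For a $d$-polytope $P$ let $f_0$ and $f_1$ be its numbers of vertices and edges, and let $\xi(P)=2f_1-d f_0$ be its excess degree; $P$ is called simple if every vertex of $P$ lies on exactly $d$ edges. Let $\Xi(d)=\{\xi(P): P \text{ is a } d\text{-polytope}\}$. Then, for every $d$-polytope $P$, $\xi(P)=0$ if and only if $P$ is simple, and $\xi(P)\ge d-2$ if $P$ is not simple. Moreover, the two smallest values in $\Xi(d)$ are $0$ and $d-2$; that is, $\min \Xi(d)=0$ and $\min\bigl(\Xi(d)\setminus\{0\}\bigr)=d-2$ (both minima are attained). -/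

import Mathlib

namespace ConvexPolytope

variable {E : Type*} [NormedAddCommGroup E] [NormedSpace ℝ E]

/-- The dimension of (the affine hull of) a set; only meant for nonempty sets. -/
noncomputable def dim (P : Set E) : ℕ := Module.finrank ℝ (vectorSpan ℝ P)

/-- `P` is a `d`-polytope: the convex hull of a nonempty finite set of points, of dimension `d`.
The ambient space may have larger dimension. -/
def IsPolytope (d : ℕ) (P : Set E) : Prop :=
  (∃ V : Set E, V.Finite ∧ V.Nonempty ∧ P = convexHull ℝ V) ∧ dim P = d

/-- The vertices of `P`: the points `v` such that `{v}` is a face of `P`, that is, such that some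
linear functional attains its maximum on `P` exactly at `v`. -/
def vertices (P : Set E) : Set E := P.exposedPoints ℝ

/-- The edges of `P`: its one-dimensional faces. A nonempty face is the set of points of `P` where
some linear functional attains its maximum on `P`. -/
def edges (P : Set E) : Set (Set E) := {F | F.Nonempty ∧ IsExposed ℝ P F ∧ dim F = 1}

/-- The degree of `u` in `P`: the number of edges of `P` incident with `u`. -/
noncomputable def degree (P : Set E) (u : E) : ℕ := {F ∈ edges P | u ∈ F}.ncard

/-- `P` is simple: every vertex of `P` has degree exactly `dim P`. -/
def IsSimple (P : Set E) : Prop := ∀ u ∈ vertices P, degree P u = dim P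

/-- The excess degree `ξ(P) = 2 f₁ - d f₀`, where `d = dim P` and `f₀`, `f₁` are the numbers of
vertices and of edges of `P`. -/
noncomputable def excess (P : Set E) : ℤ :=
  2 * ((edges P).ncard : ℤ) - (dim P : ℤ) * ((vertices P).ncard : ℤ)

/-- `Ξ(d)`: the set of values of the excess degree on all `d`-polytopes. -/
def excessValues (d : ℕ) : Set ℤ :=
  {x | ∃ (n : ℕ) (P : Set (EuclideanSpace ℝ (Fin n))), IsPolytope d P ∧ excess P = x}

end ConvexPolytope

namespace ConvexPolytope

section Faces

variable {E : Type*} [NormedAddCommGroup E] [NormedSpace ℝ E] {P F G : Set E} {d : ℕ} {u x y : E}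

/-! ### Exposed faces and supporting functionals -/

/-! Counting vertex–edge incidences twice turns the excess into the sum of `degree P v - d` over the
vertices. Each term is nonnegative, because the edge directions at a vertex span the direction space
of `P` (`vectorSpan_le_span_nbrs`); so the excess vanishes exactly when `P` is simple.

The gap (`le_excess_of_not_isSimple`) is proved by induction on `d`. Suppose the excess is below `d
- 2` and `u` is a nonsimple vertex. Two distinct facets through `u` must meet in dimension `d - 2`:
an intersection of smaller dimension `k` has at least `k + 1` vertices, each contributing at least
`d - 2 - k` (`le_excess_of_facets`). If some facet `F` through `u` is simple at `u`, the ridge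
condition allows only one edge at `u` to leave `F` (`eq_of_simple_facet`), so `u` has degree `d`.
Otherwise each facet `F` through `u` is nonsimple, hence has excess at least `d - 3` by induction.
Every vertex of `F` has a neighbour outside `F`, so the terms for `P` dominate those for `F`, and a
second outside neighbour of `u` would raise the total to `d - 2` (`degree_le_of_nonsimple_facet`). A
facet through `u` that misses a neighbour then contains all the others, which makes the edge
directions at `u` independent (`ncard_nbrs_le_of_faces`). In both cases `u` turns out to be simple.

The value `0` comes from a simplex. The value `d - 2` comes from the `(d - 2)`-fold pyramid over a
parallelogram: its apexes have degree `d + 1`, its base vertices degree `d`. -/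

theorem exists_functional (hF : IsExposed ℝ P F) (hu : u ∈ F) :
    ∃ l : StrongDual ℝ E, (∀ y ∈ P, l y ≤ l u) ∧ ∀ y ∈ P, (y ∈ F ↔ l y = l u) := by
  obtain ⟨l, rfl⟩ := hF ⟨u, hu⟩
  exact ⟨l, hu.2, fun y hy => ⟨fun h => le_antisymm (hu.2 y hy) (h.2 u hu.1),
    fun h => ⟨hy, fun z hz => h ▸ hu.2 z hz⟩⟩⟩

theorem isExposed_of_functional (l : StrongDual ℝ E) (hu : u ∈ P) (h : ∀ y ∈ P, l y ≤ l u) :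
    IsExposed ℝ P {y ∈ P | l y = l u} := fun _ =>
  ⟨l, Set.ext fun _ => and_congr_right fun _ =>
    ⟨fun e z hz => e ▸ h z hz, fun e => le_antisymm (h _ ‹_›) (e u hu)⟩⟩

theorem vectorSpan_le_ker {l : E →ₗ[ℝ] ℝ} {c : ℝ} (h : ∀ y ∈ F, l y = c) :
    vectorSpan ℝ F ≤ LinearMap.ker l := by
  rw [vectorSpan_def, Submodule.span_le]
  rintro _ ⟨a, ha, b, hb, rfl⟩
  simp [h a ha, h b hb]

/-- A face is the intersection of `P` with its own affine span, since its supporting functional is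
constant on that span. -/
theorem mem_of_sub_mem_vectorSpan (hF : IsExposed ℝ P F) (hu : u ∈ F) (hy : y ∈ P)
    (h : y - u ∈ vectorSpan ℝ F) : y ∈ F := by
  obtain ⟨l, -, hl⟩ := exists_functional hF hu
  have hk := vectorSpan_le_ker (l := (l : E →ₗ[ℝ] ℝ)) (c := l u)
    (fun z hz => (hl z (hF.subset hz)).1 hz) h
  rw [hl y hy]
  simpa [sub_eq_zero] using hk

theorem vectorSpan_convexHull (s : Set E) :
    vectorSpan ℝ (convexHull ℝ s) = vectorSpan ℝ s := by
  rw [← direction_affineSpan, affineSpan_convexHull, direction_affineSpan]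

theorem vectorSpan_le_of_sub_mem {s : Set E} (W : Submodule ℝ E) (u : E)
    (h : ∀ v ∈ s, v - u ∈ W) : vectorSpan ℝ s ≤ W := by
  rw [vectorSpan_def, Submodule.span_le]
  rintro _ ⟨a, ha, b, hb, rfl⟩
  simpa using W.sub_mem (h a ha) (h b hb)

section Finite

variable [FiniteDimensional ℝ E]

theorem dim_mono {s t : Set E} (h : s ⊆ t) : dim s ≤ dim t :=
  Submodule.finrank_mono (vectorSpan_mono ℝ h)

theorem eq_of_subset_of_dim_eq (hF : IsExposed ℝ P F) (hFne : F.Nonempty) (hFG : F ⊆ G)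
    (hGP : G ⊆ P) (hd : dim G ≤ dim F) : F = G := by
  obtain ⟨u, hu⟩ := hFne
  have hv : vectorSpan ℝ F = vectorSpan ℝ G :=
    Submodule.eq_of_le_of_finrank_le (vectorSpan_mono ℝ hFG) hd
  refine hFG.antisymm fun y hy => mem_of_sub_mem_vectorSpan hF hu (hGP hy) ?_
  rw [hv]
  exact vsub_mem_vectorSpan ℝ hy (hFG hu)

theorem dim_lt_of_ssubset (hF : IsExposed ℝ P F) (hFne : F.Nonempty) (hFG : F ⊂ G)
    (hGP : G ⊆ P) : dim F < dim G := by
  by_contra! h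
  exact hFG.ne (eq_of_subset_of_dim_eq hF hFne hFG.1 hGP h)

end Finite

/-! ### Polytopes as convex hulls of their vertices -/

theorem IsPolytope.convex (hP : IsPolytope d P) : Convex ℝ P := by
  obtain ⟨⟨V, -, -, rfl⟩, -⟩ := hP
  exact convex_convexHull ℝ V

theorem IsPolytope.isCompact (hP : IsPolytope d P) : IsCompact P := by
  obtain ⟨⟨V, hV, -, rfl⟩, -⟩ := hP
  exact hV.isCompact_convexHull ℝ

theorem IsPolytope.nonempty (hP : IsPolytope d P) : P.Nonempty := by
  obtain ⟨⟨V, -, hV, rfl⟩, -⟩ := hP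
  exact hV.convexHull

theorem IsPolytope.vertices_eq_extremePoints (hP : IsPolytope d P) :
    vertices P = P.extremePoints ℝ := by
  refine exposedPoints_subset_extremePoints.antisymm ?_
  obtain ⟨⟨V, hV, -, rfl⟩, -⟩ := hP
  intro x hx
  have hxV : x ∉ convexHull ℝ (V \ {x}) := fun h =>
    ((convex_convexHull ℝ V).mem_extremePoints_iff_mem_sdiff_convexHull_sdiff.1 hx).2
      (convexHull_mono (Set.sdiff_subset_sdiff_left (subset_convexHull ℝ V)) h)
  have hxV' : x ∈ V := extremePoints_convexHull_subset hx
  -- Strict separation of `x` from the hull of the other generators: the face where `l` is maximal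
  -- then has `x` as its only extreme point, so by Krein–Milman it is `{x}`.
  obtain ⟨l, c, hl, hc⟩ := geometric_hahn_banach_closed_point
    (convex_convexHull ℝ (V \ {x})) ((hV.sdiff).isClosed_convexHull ℝ) hxV
  have hle : ∀ y ∈ convexHull ℝ V, l y ≤ l x := by
    have : convexHull ℝ V ⊆ {y | l y ≤ l x} := by
      refine convexHull_min (fun v hv => ?_) (convex_halfSpace_le l.isLinear _)
      by_cases h : v = x
      · simp [h]
      · exact ((hl v (subset_convexHull ℝ _ ⟨hv, h⟩)).trans hc).le
    exact this
  have hF := isExposed_of_functional l hx.1 hle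
  set F : Set E := {y ∈ convexHull ℝ V | l y = l x} with hFdef
  have hxF : x ∈ F := ⟨hx.1, rfl⟩
  have hFc : IsCompact F := hF.isCompact (hV.isCompact_convexHull ℝ)
  have hsub : F.extremePoints ℝ ⊆ {x} := by
    intro v hv
    have hvV := extremePoints_convexHull_subset (hF.isExtreme.extremePoints_subset_extremePoints hv)
    by_contra h
    exact ((hl v (subset_convexHull ℝ _ ⟨hvV, h⟩)).trans hc).ne hv.1.2
  have hFx : F = {x} := by
    refine Set.Subset.antisymm ?_ (by simpa using hxF)
    rw [← closure_convexHull_extremePoints hFc (hF.convex (convex_convexHull ℝ V))]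
    refine closure_minimal (convexHull_min hsub (convex_singleton x)) isClosed_singleton
  change x ∈ (convexHull ℝ V).exposedPoints ℝ
  rw [mem_exposedPoints_iff_exposed_singleton, ← hFx]
  exact hF

theorem IsPolytope.finite_vertices (hP : IsPolytope d P) : (vertices P).Finite := by
  rw [hP.vertices_eq_extremePoints]
  obtain ⟨⟨V, hV, -, rfl⟩, -⟩ := hP
  exact hV.subset extremePoints_convexHull_subset

theorem vertices_subset (P : Set E) : vertices P ⊆ P := exposedPoints_subset

theorem eq_convexHull_of_extremePoints_subset {s : Set E} (hc : IsCompact P) (hP : Convex ℝ P)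
    (hs : s.Finite) (hsub : P.extremePoints ℝ ⊆ s) (hsP : s ⊆ P) : P = convexHull ℝ s := by
  refine Set.Subset.antisymm ?_ (convexHull_min hsP hP)
  conv_lhs => rw [← closure_convexHull_extremePoints hc hP]
  exact closure_minimal (convexHull_mono hsub) (hs.isClosed_convexHull ℝ)

theorem IsPolytope.eq_convexHull_vertices (hP : IsPolytope d P) :
    P = convexHull ℝ (vertices P) :=
  eq_convexHull_of_extremePoints_subset hP.isCompact hP.convex hP.finite_vertices
    hP.vertices_eq_extremePoints.ge (vertices_subset P)

theorem IsPolytope.vectorSpan_vertices (hP : IsPolytope d P) :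
    vectorSpan ℝ (vertices P) = vectorSpan ℝ P := by
  rw [← vectorSpan_convexHull, ← hP.eq_convexHull_vertices]

theorem IsPolytope.le_of_forall_vertices (hP : IsPolytope d P) {l : StrongDual ℝ E} {c : ℝ}
    (h : ∀ v ∈ vertices P, l v ≤ c) : ∀ y ∈ P, l y ≤ c := by
  have : convexHull ℝ (vertices P) ⊆ {y | l y ≤ c} :=
    convexHull_min h (convex_halfSpace_le l.isLinear _)
  rwa [← hP.eq_convexHull_vertices] at this

/-! ### Faces of polytopes -/

theorem IsPolytope.face (hP : IsPolytope d P) (hF : IsExposed ℝ P F) (hne : F.Nonempty) :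
    IsPolytope (dim F) F := by
  have hc := hF.isCompact hP.isCompact
  have hsub : F.extremePoints ℝ ⊆ vertices P := by
    rw [hP.vertices_eq_extremePoints]
    exact hF.isExtreme.extremePoints_subset_extremePoints
  refine ⟨⟨F.extremePoints ℝ, hP.finite_vertices.subset hsub,
    hc.extremePoints_nonempty hne, ?_⟩, rfl⟩
  exact eq_convexHull_of_extremePoints_subset hc (hF.convex hP.convex)
    (hP.finite_vertices.subset hsub) subset_rfl extremePoints_subset

theorem IsPolytope.vertices_face (hP : IsPolytope d P) (hF : IsExposed ℝ P F) (hne : F.Nonempty) :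
    vertices F = vertices P ∩ F := by
  ext v
  constructor
  · intro hv
    refine ⟨?_, vertices_subset F hv⟩
    rw [(hP.face hF hne).vertices_eq_extremePoints] at hv
    rw [hP.vertices_eq_extremePoints]
    exact hF.isExtreme.extremePoints_subset_extremePoints hv
  · rintro ⟨hv, hvF⟩
    unfold vertices at *
    rw [mem_exposedPoints_iff_exposed_singleton] at *
    exact hv.mono hF.subset (by simpa using hvF)

theorem IsPolytope.isExposed_trans (hP : IsPolytope d P) (hF : IsExposed ℝ P F)
    (hG : IsExposed ℝ F G) : IsExposed ℝ P G := by
  intro hGne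
  obtain ⟨u, hu⟩ := hGne
  have huF := hG.subset hu
  obtain ⟨l, hl, hlF⟩ := exists_functional hF huF
  obtain ⟨m, hm, hmG⟩ := exists_functional hG hu
  -- With `l` cutting out `F` in `P` and `m` cutting out `G` in `F`, the functional `N • l + m` cuts
  -- out `G` in `P` once `N` is large; finiteness of the vertex set provides such an `N`.
  have hN : ∀ᶠ N : ℝ in Filter.atTop, ∀ v ∈ vertices P \ F, m v - m u < N * (l u - l v) := by
    rw [Filter.eventually_all_finite hP.finite_vertices.sdiff]
    intro v hv
    have hpos : 0 < l u - l v := by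
      have hvP := vertices_subset P hv.1
      exact sub_pos.2 (lt_of_le_of_ne (hl v hvP) fun h => hv.2 ((hlF v hvP).2 h))
    filter_upwards [Filter.eventually_gt_atTop ((m v - m u) / (l u - l v))] with N hN
    exact (div_lt_iff₀ hpos).1 hN
  obtain ⟨N, hN⟩ := hN.exists
  set L : StrongDual ℝ E := N • l + m with hL
  have hLap : ∀ z, L z = N * l z + m z := fun z => by simp [hL]
  have hv1 : ∀ v ∈ vertices P, v ∉ F → L v < L u := fun v hv hvF => by
    have := hN v ⟨hv, hvF⟩
    rw [hLap, hLap]; linarith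
  have hF1 : ∀ v ∈ F, L v ≤ L u ∧ (L v = L u ↔ v ∈ G) := fun v hv => by
    have h1 := (hlF v (hF.subset hv)).1 hv
    rw [hLap, hLap, h1, hmG v hv]
    exact ⟨by linarith [hm v hv], by constructor <;> intro h <;> linarith⟩
  have hle : ∀ y ∈ P, L y ≤ L u := hP.le_of_forall_vertices fun v hv => by
    by_cases h : v ∈ F
    · exact (hF1 v h).1
    · exact (hv1 v hv h).le
  have hE := isExposed_of_functional L (hF.subset huF) hle
  have hEG : {y ∈ P | L y = L u} = G := by
    have hne : {y ∈ P | L y = L u}.Nonempty := ⟨u, hF.subset huF, rfl⟩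
    refine Set.Subset.antisymm ?_ fun y hy =>
      ⟨hF.subset (hG.subset hy), (hF1 y (hG.subset hy)).2.2 hy⟩
    rw [(hP.face hE hne).eq_convexHull_vertices, hP.vertices_face hE hne]
    refine convexHull_min ?_ (hG.convex (hF.convex hP.convex))
    rintro v ⟨hv, -, hvL⟩
    by_cases h : v ∈ F
    · exact (hF1 v h).2.1 hvL
    · exact absurd hvL (hv1 v hv h).ne
  rw [hEG] at hE
  exact hE ⟨u, hu⟩

/-! ### Every face is cut out by facets -/

/-- Rotate the supporting hyperplane about `F` and `x`: add to `l` a multiple of a functional `f`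
that is constant on `F ∪ {x}`, until a further vertex is reached. The codimension assumption leaves
room for a nontrivial `f`, and `x` stays off the new face because its gap under `l` is unchanged. -/
theorem IsPolytope.exists_larger_face [FiniteDimensional ℝ E] (hP : IsPolytope d P)
    (hF : IsExposed ℝ P F) (hne : F.Nonempty) (hx : x ∈ P) (hxF : x ∉ F)
    (hdim : dim F + 1 < dim P) : ∃ G, IsExposed ℝ P G ∧ F ⊂ G ∧ x ∉ G := by
  obtain ⟨u, hu⟩ := hne
  have huP := hF.subset hu
  obtain ⟨l, hl, hlF⟩ := exists_functional hF hu
  let W : Submodule ℝ E := vectorSpan ℝ F ⊔ Submodule.span ℝ {x - u}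
  have hW : Module.finrank ℝ W < dim P := by
    have h1 : Module.finrank ℝ W ≤ _ :=
      Submodule.finrank_add_le_finrank_add_finrank (vectorSpan ℝ F)
      (Submodule.span ℝ {x - u})
    have h2 := (finrank_span_le_card (R := ℝ) {x - u}).trans (by simp : _ ≤ 1)
    have h3 : Module.finrank ℝ (vectorSpan ℝ F) = dim F := rfl
    omega
  obtain ⟨v, hv, hvW⟩ : ∃ v ∈ vertices P, v - u ∉ W := by
    by_contra! h
    have := Submodule.finrank_mono (vectorSpan_le_of_sub_mem W u h)
    rw [hP.vectorSpan_vertices] at this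
    exact absurd this (not_le.2 hW)
  obtain ⟨f₀, hf₀, hf₀W⟩ := Submodule.exists_le_ker_of_notMem hvW
  let f : StrongDual ℝ E := LinearMap.toContinuousLinearMap ((f₀ (v - u))⁻¹ • f₀)
  have hfv : f (v - u) = 1 := by simpa [f] using inv_mul_cancel₀ hf₀
  have hfW : ∀ w ∈ W, f w = 0 := fun w hw => by
    have : f₀ w = 0 := hf₀W hw
    simp [f, this]
  have hfF : ∀ y ∈ F, f y = f u := fun y hy => by
    have := hfW (y - u) (Submodule.mem_sup_left (vsub_mem_vectorSpan ℝ hy hu))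
    rwa [map_sub, sub_eq_zero] at this
  have hfx : f x = f u := by
    have := hfW (x - u) (Submodule.mem_sup_right (Submodule.mem_span_singleton_self _))
    rwa [map_sub, sub_eq_zero] at this
  obtain ⟨w, ⟨hw, hwf⟩, hmin⟩ := Set.exists_min_image {w ∈ vertices P | 0 < f w - f u}
    (fun w => (l u - l w) / (f w - f u)) (hP.finite_vertices.subset (Set.sep_subset _ _))
    ⟨v, hv, by rw [← map_sub, hfv]; exact one_pos⟩
  have hwP := vertices_subset P hw
  -- The least ratio over vertices with `f` above `f u`: the tilt at which the first such vertex `w`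
  -- reaches the hyperplane.
  set t := (l u - l w) / (f w - f u) with ht
  have ht0 : 0 ≤ t := div_nonneg (sub_nonneg.2 (hl w hwP)) hwf.le
  have htw : t * (f w - f u) = l u - l w := div_mul_cancel₀ _ hwf.ne'
  set L : StrongDual ℝ E := l + t • f with hL
  have hLap : ∀ z, L z = l z + t * f z := fun z => by simp [hL]
  have hle : ∀ y ∈ P, L y ≤ L u := hP.le_of_forall_vertices fun z hz => by
    rw [hLap, hLap]
    have hlz := hl z (vertices_subset P hz)
    rcases le_or_gt (f z - f u) 0 with h | h
    · nlinarith
    · have := (le_div_iff₀ h).1 (hmin z ⟨hz, h⟩)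
      linarith
  refine ⟨_, isExposed_of_functional L huP hle, ⟨fun y hy => ⟨hF.subset hy, ?_⟩, fun h => ?_⟩, ?_⟩
  · rw [hLap, hLap, hfF y hy, (hlF y (hF.subset hy)).1 hy]
  · have hwF : w ∈ F := h ⟨hwP, by rw [hLap, hLap]; linarith⟩
    rw [hfF w hwF, sub_self] at hwf
    exact hwf.false
  · rintro ⟨-, h⟩
    rw [hLap, hLap, hfx] at h
    exact hxF ((hlF x hx).2 (by linarith))

theorem IsPolytope.exists_facet [FiniteDimensional ℝ E] (hP : IsPolytope d P)
    (hF : IsExposed ℝ P F) (hne : F.Nonempty) (hx : x ∈ P) (hxF : x ∉ F) :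
    ∃ G, IsExposed ℝ P G ∧ F ⊆ G ∧ x ∉ G ∧ dim G + 1 = dim P := by
  induction hk : dim P - dim F using Nat.strong_induction_on generalizing F with
  | _ k ih =>
    have hlt : dim F < dim P :=
      dim_lt_of_ssubset hF hne ⟨hF.subset, fun h => hxF (h hx)⟩ subset_rfl
    by_cases h : dim F + 1 = dim P
    · exact ⟨F, hF, subset_rfl, hxF, h⟩
    obtain ⟨G, hG, hFG, hxG⟩ := hP.exists_larger_face hF hne hx hxF (by omega)
    have hlt' := dim_lt_of_ssubset hF hne hFG hG.subset
    obtain ⟨H, hH, hGH, hxH, hdim⟩ := ih _ (by omega) hG (hne.mono hFG.1) hxG rfl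
    exact ⟨H, hH, hFG.1.trans hGH, hxH, hdim⟩

end Faces

section Neighbours

variable {E : Type*} [NormedAddCommGroup E] [NormedSpace ℝ E] {P F G e : Set E} {d : ℕ}
  {u w x y : E}

/-! ### Neighbours of a vertex -/

/-- The neighbours of `u` in `P`: the other endpoints of the edges of `P` incident with `u`. -/
def nbrs (P : Set E) (u : E) : Set E := {w | w ≠ u ∧ segment ℝ u w ∈ edges P}

theorem dim_singleton (u : E) : dim ({u} : Set E) = 0 := by simp [dim]

theorem eq_or_eq_of_mem_segment {A : Set E} {a b c : E} (hb : b ∈ A.extremePoints ℝ) (ha : a ∈ A)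
    (hc : c ∈ A) (h : b ∈ segment ℝ a c) : b = a ∨ b = c := by
  rw [← insert_endpoints_openSegment] at h
  rcases h with h | h | h
  · exact Or.inl h
  · exact Or.inr h
  · exact Or.inl (hb.2 ha hc h).symm

theorem exists_eq_pair_of_dim_eq_one (hP : IsPolytope d P) (h1 : dim P = 1) (hu : u ∈ vertices P) :
    ∃ w ≠ u, vertices P = {u, w} := by
  obtain ⟨w, hw, hwu⟩ : ∃ w ∈ vertices P, w ≠ u := by
    by_contra! h
    have hs : vertices P = {u} := Set.eq_singleton_iff_unique_mem.2 ⟨hu, h⟩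
    have := hP.eq_convexHull_vertices
    rw [hs, convexHull_singleton] at this
    rw [this, dim_singleton] at h1
    exact one_ne_zero h1.symm
  refine ⟨w, hwu, Set.Subset.antisymm (fun z hz => ?_) (by simp [Set.insert_subset_iff, hu, hw])⟩
  have hfd : FiniteDimensional ℝ (vectorSpan ℝ P) := Module.finite_of_finrank_eq_succ h1
  have hcol : Collinear ℝ ({u, w, z} : Set E) := by
    have hsub : ({u, w, z} : Set E) ⊆ P := by
      simp only [Set.insert_subset_iff, Set.singleton_subset_iff]
      exact ⟨vertices_subset P hu, vertices_subset P hw, vertices_subset P hz⟩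
    refine Collinear.subset hsub ?_
    rw [collinear_iff_finrank_le_one]
    exact h1.le
  rw [hP.vertices_eq_extremePoints] at hu hw hz
  rcases hcol.wbtw_or_wbtw_or_wbtw with h | h | h <;> rw [← mem_segment_iff_wbtw] at h
  · exact (eq_or_eq_of_mem_segment hw hu.1 hz.1 h).elim (absurd · hwu) fun h => Or.inr h.symm
  · exact (eq_or_eq_of_mem_segment hz hw.1 hu.1 h).symm
  · exact (eq_or_eq_of_mem_segment hu hz.1 hw.1 h).elim (fun h => Or.inl h.symm)
      (absurd ·.symm hwu)

theorem IsPolytope.edge (hP : IsPolytope d P) (he : e ∈ edges P) : IsPolytope 1 e :=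
  he.2.2 ▸ hP.face he.2.1 he.1

theorem IsPolytope.vertices_segment (hP : IsPolytope d P) (hwu : w ≠ u)
    (he : segment ℝ u w ∈ edges P) : vertices (segment ℝ u w) = {u, w} := by
  have hp := hP.edge he
  have hsub : vertices (segment ℝ u w) ⊆ {u, w} := by
    rw [hp.vertices_eq_extremePoints, ← convexHull_pair]
    exact extremePoints_convexHull_subset
  have hne : (vertices (segment ℝ u w)).Nonempty := by
    rw [hp.vertices_eq_extremePoints]
    exact hp.isCompact.extremePoints_nonempty hp.nonempty
  obtain ⟨a, ha⟩ := hne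
  obtain ⟨b, hba, hab⟩ := exists_eq_pair_of_dim_eq_one hp he.2.2 ha
  refine hsub.antisymm ?_
  have ha' := hsub ha
  have hb' := hsub (hab ▸ Set.mem_insert_of_mem a rfl : b ∈ vertices (segment ℝ u w))
  rw [hab]
  rcases ha' with rfl | rfl <;> rcases hb' with rfl | rfl
  · exact absurd rfl hba
  · exact subset_rfl
  · exact (Set.pair_comm _ _).le
  · exact absurd rfl hba

theorem IsPolytope.nbrs_subset_vertices (hP : IsPolytope d P) : nbrs P u ⊆ vertices P := by
  rintro w ⟨hwu, he⟩
  have h := hP.vertices_segment hwu he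
  rw [hP.vertices_face he.2.1 he.1] at h
  exact (h.symm ▸ Set.mem_insert_of_mem u rfl : w ∈ vertices P ∩ segment ℝ u w).1

theorem IsPolytope.nbrs_subset (hP : IsPolytope d P) : nbrs P u ⊆ P :=
  hP.nbrs_subset_vertices.trans (vertices_subset P)

theorem IsPolytope.finite_nbrs (hP : IsPolytope d P) : (nbrs P u).Finite :=
  hP.finite_vertices.subset hP.nbrs_subset_vertices

theorem IsPolytope.exists_eq_segment (hP : IsPolytope d P) (he : e ∈ edges P)
    (hu : u ∈ vertices P) (hue : u ∈ e) : ∃ w ∈ nbrs P u, segment ℝ u w = e := by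
  have hp := hP.edge he
  have hu' : u ∈ vertices e := by
    rw [hP.vertices_face he.2.1 he.1]
    exact ⟨hu, hue⟩
  obtain ⟨w, hwu, hw⟩ := exists_eq_pair_of_dim_eq_one hp he.2.2 hu'
  have hs : segment ℝ u w = e := by
    rw [← convexHull_pair, ← hw, ← hp.eq_convexHull_vertices]
  exact ⟨w, ⟨hwu, hs ▸ he⟩, hs⟩

theorem IsPolytope.degree_eq (hP : IsPolytope d P) (hu : u ∈ vertices P) :
    degree P u = (nbrs P u).ncard := by
  have himg : {e ∈ edges P | u ∈ e} = segment ℝ u '' nbrs P u := by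
    ext e
    constructor
    · rintro ⟨he, hue⟩
      exact hP.exists_eq_segment he hu hue
    · rintro ⟨w, hw, rfl⟩
      exact ⟨hw.2, left_mem_segment ℝ u w⟩
  rw [degree, himg]
  refine Set.InjOn.ncard_image fun a ha b hb hab => ?_
  have h1 := hP.vertices_segment ha.1 ha.2
  have h2 := hP.vertices_segment hb.1 hb.2
  have : a ∈ ({u, b} : Set E) := by
    rw [← h2, ← (show segment ℝ u a = segment ℝ u b from hab), h1]
    simp
  exact this.resolve_left ha.1

theorem IsPolytope.nbrs_face (hP : IsPolytope d P) (hF : IsExposed ℝ P F) (hu : u ∈ F) :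
    nbrs F u = nbrs P u ∩ F := by
  ext w
  constructor
  · rintro ⟨hwu, hne, hexp, hdim⟩
    exact ⟨⟨hwu, hne, hP.isExposed_trans hF hexp, hdim⟩, hexp.subset (right_mem_segment ℝ u w)⟩
  · rintro ⟨⟨hwu, hne, hexp, hdim⟩, hw⟩
    exact ⟨hwu, hne, hexp.mono hF.subset ((hF.convex hP.convex).segment_subset hu hw), hdim⟩

/-! ### Double counting of vertex–edge incidences -/

theorem IsPolytope.finite_edges (hP : IsPolytope d P) : (edges P).Finite := by
  refine Set.Finite.of_finite_image (f := vertices)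
    (hP.finite_vertices.finite_subsets.subset ?_) fun a ha b hb hab => ?_
  · rintro _ ⟨e, he, rfl⟩
    change vertices e ⊆ vertices P
    rw [hP.vertices_face he.2.1 he.1]
    exact Set.inter_subset_left
  · rw [(hP.edge ha).eq_convexHull_vertices, (hP.edge hb).eq_convexHull_vertices, hab]

theorem IsPolytope.vertices_nonempty (hP : IsPolytope d P) : (vertices P).Nonempty := by
  rw [hP.vertices_eq_extremePoints]
  exact hP.isCompact.extremePoints_nonempty hP.nonempty

theorem IsPolytope.ncard_vertices_edge (hP : IsPolytope d P) (he : e ∈ edges P) :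
    {u ∈ vertices P | u ∈ e}.ncard = 2 := by
  have h := hP.vertices_face he.2.1 he.1
  obtain ⟨u, hu⟩ := (hP.edge he).vertices_nonempty
  obtain ⟨w, hwu, hw⟩ := exists_eq_pair_of_dim_eq_one (hP.edge he) he.2.2 hu
  change (vertices P ∩ e).ncard = 2
  rw [← h, hw, Set.ncard_pair hwu.symm]

theorem IsPolytope.sum_degree (hP : IsPolytope d P) :
    ∑ v ∈ hP.finite_vertices.toFinset, degree P v = 2 * (edges P).ncard := by
  classical
  have := Finset.sum_card_bipartiteAbove_eq_sum_card_bipartiteBelow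
    (s := hP.finite_vertices.toFinset) (t := hP.finite_edges.toFinset) (fun v e => v ∈ e)
  have h1 : ∀ v, (Finset.bipartiteAbove (fun v e => v ∈ e) hP.finite_edges.toFinset v).card
      = degree P v := fun v => by
    rw [degree, ← Set.ncard_coe_finset]
    congr 1
    ext e
    simp [Finset.bipartiteAbove]
  have h2 : ∀ e ∈ hP.finite_edges.toFinset,
      (Finset.bipartiteBelow (fun v e => v ∈ e) hP.finite_vertices.toFinset e).card = 2 := by
    intro e he
    rw [← hP.ncard_vertices_edge (by simpa using he), ← Set.ncard_coe_finset]
    congr 1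
    ext v
    simp [Finset.bipartiteBelow]
  simp only [h1] at this
  rw [this, Finset.sum_congr rfl h2, Finset.sum_const, smul_eq_mul, mul_comm,
    Set.ncard_eq_toFinset_card _ hP.finite_edges]

theorem IsPolytope.excess_eq_sum (hP : IsPolytope d P) :
    excess P = ∑ v ∈ hP.finite_vertices.toFinset, ((degree P v : ℤ) - d) := by
  have h := hP.sum_degree
  rw [Finset.sum_sub_distrib, ← Nat.cast_sum, h, Finset.sum_const, excess, hP.2,
    ← Set.ncard_eq_toFinset_card _ hP.finite_vertices]
  push_cast
  ring

/-! ### The edges at a vertex span the polytope -/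

theorem isExposed_vertex (hu : u ∈ vertices P) : IsExposed ℝ P {u} :=
  mem_exposedPoints_iff_exposed_singleton.1 hu

section Finite

variable [FiniteDimensional ℝ E]

theorem exists_ne_of_dim_pos (h : 0 < dim P) (u : E) : ∃ x ∈ P, x ≠ u := by
  by_contra! hc
  have : dim P ≤ dim ({u} : Set E) := dim_mono hc
  rw [dim_singleton] at this
  omega

/-- By induction on dimension: two distinct facets through `u` together span the directions of `P`,
and neighbours of `u` in a facet are neighbours in `P`. -/
theorem IsPolytope.vectorSpan_le_span_nbrs (hP : IsPolytope d P) (hu : u ∈ vertices P) :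
    vectorSpan ℝ P ≤ Submodule.span ℝ ((· - u) '' nbrs P u) := by
  induction d using Nat.strong_induction_on generalizing P with
  | _ d ih =>
    have huP := vertices_subset P hu
    rcases Nat.lt_or_ge d 2 with hd | hd
    · obtain rfl | rfl : d = 0 ∨ d = 1 := by omega
      · have : vectorSpan ℝ P = ⊥ := Submodule.finrank_eq_zero.1 hP.2
        rw [this]
        exact bot_le
      · obtain ⟨w, hw, hs⟩ := hP.exists_eq_segment ⟨hP.nonempty, IsExposed.refl P, hP.2⟩ hu huP
        conv_lhs => rw [← hs, ← convexHull_pair, vectorSpan_convexHull]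
        refine vectorSpan_le_of_sub_mem _ u ?_
        rintro v (rfl | rfl)
        · simp
        · exact Submodule.subset_span ⟨v, hw, rfl⟩
    · have hdim := hP.2
      have key : ∀ F, IsExposed ℝ P F → u ∈ F → dim F + 1 = dim P →
          vectorSpan ℝ F ≤ Submodule.span ℝ ((· - u) '' nbrs P u) := by
        intro F hF huF hFd
        refine (ih (dim F) (by omega) (hP.face hF ⟨u, huF⟩) ?_).trans (Submodule.span_mono ?_)
        · rw [hP.vertices_face hF ⟨u, huF⟩]
          exact ⟨hu, huF⟩
        · rw [hP.nbrs_face hF huF]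
          exact Set.image_mono Set.inter_subset_left
      obtain ⟨x, hx, hxu⟩ := exists_ne_of_dim_pos (by omega : 0 < dim P) u
      obtain ⟨F, hF, huF, -, hFd⟩ :=
        hP.exists_facet (isExposed_vertex hu) (Set.singleton_nonempty u) hx hxu
      rw [Set.singleton_subset_iff] at huF
      -- A facet through `u` that misses a point `y` of `F` is certainly different from `F`.
      obtain ⟨y, hy, hyu⟩ := exists_ne_of_dim_pos (by omega : 0 < dim F) u
      obtain ⟨G, hG, huG, hyG, hGd⟩ :=
        hP.exists_facet (isExposed_vertex hu) (Set.singleton_nonempty u) (hF.subset hy) hyu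
      rw [Set.singleton_subset_iff] at huG
      obtain ⟨z, hz, hzF⟩ : ∃ z ∈ G, z ∉ F := by
        by_contra! h
        exact hyG (eq_of_subset_of_dim_eq hG ⟨u, huG⟩ h hF.subset (by omega) ▸ hy)
      have hlt : vectorSpan ℝ F < vectorSpan ℝ F ⊔ vectorSpan ℝ G := by
        refine lt_of_le_of_ne le_sup_left fun h => hzF ?_
        refine mem_of_sub_mem_vectorSpan hF huF (hG.subset hz) ?_
        rw [h]
        exact Submodule.mem_sup_right (vsub_mem_vectorSpan ℝ hz huG)
      have hfr := Submodule.finrank_lt_finrank_of_lt hlt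
      have hFd' : Module.finrank ℝ (vectorSpan ℝ F) + 1 = dim P := hFd
      have heq : vectorSpan ℝ F ⊔ vectorSpan ℝ G = vectorSpan ℝ P :=
        Submodule.eq_of_le_of_finrank_le
          (sup_le (vectorSpan_mono ℝ hF.subset) (vectorSpan_mono ℝ hG.subset))
          (by change dim P ≤ _; omega)
      rw [← heq]
      exact sup_le (key F hF huF hFd) (key G hG huG hGd)

theorem IsPolytope.le_ncard_nbrs (hP : IsPolytope d P) (hu : u ∈ vertices P) :
    d ≤ (nbrs P u).ncard := by
  have h := Submodule.finrank_mono (hP.vectorSpan_le_span_nbrs hu)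
  have h1 : Module.finrank ℝ (vectorSpan ℝ P) = d := hP.2
  have h2 := (hP.finite_nbrs (u := u)).image (· - u)
  have h3 := finrank_span_finset_le_card (R := ℝ) h2.toFinset
  rw [Set.finrank, h2.coe_toFinset, ← Set.ncard_eq_toFinset_card _ h2] at h3
  have h4 := Set.ncard_image_le (f := (· - u)) (hP.finite_nbrs (u := u))
  omega

theorem IsPolytope.le_degree (hP : IsPolytope d P) (hu : u ∈ vertices P) : d ≤ degree P u :=
  hP.degree_eq hu ▸ hP.le_ncard_nbrs hu

theorem IsPolytope.excess_nonneg (hP : IsPolytope d P) : 0 ≤ excess P := by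
  rw [hP.excess_eq_sum]
  refine Finset.sum_nonneg fun v hv => ?_
  have := hP.le_degree (by simpa using hv : v ∈ vertices P)
  omega

theorem IsPolytope.excess_eq_zero_iff (hP : IsPolytope d P) : excess P = 0 ↔ IsSimple P := by
  rw [hP.excess_eq_sum, Finset.sum_eq_zero_iff_of_nonneg]
  · simp only [IsSimple, Set.Finite.mem_toFinset, hP.2, sub_eq_zero, Nat.cast_inj]
  · intro v hv
    have := hP.le_degree (by simpa using hv : v ∈ vertices P)
    omega

theorem IsPolytope.sum_le_excess (hP : IsPolytope d P) {s : Finset E} {f : E → ℤ}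
    (hs : ∀ v ∈ s, v ∈ vertices P) (hf : ∀ v ∈ s, f v ≤ (degree P v : ℤ) - d) :
    ∑ v ∈ s, f v ≤ excess P := by
  rw [hP.excess_eq_sum]
  refine (Finset.sum_le_sum hf).trans (Finset.sum_le_sum_of_subset_of_nonneg ?_ ?_)
  · intro v hv
    simpa using hs v hv
  · intro v hv _
    have := hP.le_degree (by simpa using hv : v ∈ vertices P)
    omega

end Finite

end Neighbours

/-! ### Lower bound for the excess of nonsimple polytopes -/

section LowerBound

variable {E : Type*} [NormedAddCommGroup E] [NormedSpace ℝ E]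
  {P F G : Set E} {d : ℕ} {u w a b : E}

theorem IsPolytope.ncard_nbrs_face_add (hP : IsPolytope d P) (hF : IsExposed ℝ P F) (hu : u ∈ F) :
    (nbrs F u).ncard + (nbrs P u \ F).ncard = (nbrs P u).ncard := by
  rw [hP.nbrs_face hF hu]
  exact Set.ncard_inter_add_ncard_sdiff_eq_ncard _ _ hP.finite_nbrs

theorem IsPolytope.mem_vertices_face (hP : IsPolytope d P) (hF : IsExposed ℝ P F)
    (hu : u ∈ vertices P) (huF : u ∈ F) : u ∈ vertices F := by
  rw [hP.vertices_face hF ⟨u, huF⟩]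
  exact ⟨hu, huF⟩

theorem IsPolytope.eq_of_mem_nbrs_of_mem_segment (hP : IsPolytope d P) (ha : a ∈ nbrs P u)
    (hb : b ∈ nbrs P u) (h : b ∈ segment ℝ u a) : b = a := by
  have hb' := hP.nbrs_subset_vertices hb
  rw [hP.vertices_eq_extremePoints] at hb'
  exact (eq_or_eq_of_mem_segment hb' (ha.2.2.1.subset (left_mem_segment ℝ u a))
    (hP.nbrs_subset ha) h).resolve_left hb.1

variable [FiniteDimensional ℝ E]

/-! ### Lower bounds for degrees from pairs of faces -/

/-- Edges at `u` span `G`; those staying in `F` only contribute directions of `F ∩ G`, so the others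
must account for the remaining dimensions. -/
theorem IsPolytope.dim_le_dim_inter_add (hP : IsPolytope d P)
    (hG : IsExposed ℝ P G) (huF : u ∈ F) (huG : u ∈ G) (hu : u ∈ vertices P) :
    dim G ≤ dim (F ∩ G) + (nbrs P u ∩ (G \ F)).ncard := by
  have huG' : u ∈ vertices G := by
    rw [hP.vertices_face hG ⟨u, huG⟩]
    exact ⟨hu, huG⟩
  have hfin : (nbrs P u ∩ (G \ F)).Finite := hP.finite_nbrs.inter_of_left _
  have hle : vectorSpan ℝ G ≤
      vectorSpan ℝ (F ∩ G) ⊔ Submodule.span ℝ ((· - u) '' (nbrs P u ∩ (G \ F))) := by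
    refine ((hP.face hG ⟨u, huG⟩).vectorSpan_le_span_nbrs huG').trans (Submodule.span_le.2 ?_)
    rintro _ ⟨w, hw, rfl⟩
    rw [hP.nbrs_face hG huG] at hw
    by_cases hwF : w ∈ F
    · exact Submodule.mem_sup_left (vsub_mem_vectorSpan ℝ ⟨hwF, hw.2⟩ ⟨huF, huG⟩)
    · exact Submodule.mem_sup_right (Submodule.subset_span ⟨w, ⟨hw.1, hw.2, hwF⟩, rfl⟩)
  have h1 := Submodule.finrank_mono hle
  have h2 := Submodule.finrank_add_le_finrank_add_finrank (vectorSpan ℝ (F ∩ G))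
    (Submodule.span ℝ ((· - u) '' (nbrs P u ∩ (G \ F))))
  have h3 := finrank_span_finset_le_card (R := ℝ) (hfin.image (· - u)).toFinset
  rw [Set.finrank, Set.Finite.coe_toFinset, ← Set.ncard_eq_toFinset_card _ (hfin.image _)] at h3
  have h4 := Set.ncard_image_le (f := (· - u)) hfin
  have h5 : Module.finrank ℝ (vectorSpan ℝ (F ∩ G)) = dim (F ∩ G) := rfl
  have h6 : Module.finrank ℝ (vectorSpan ℝ G) = dim G := rfl
  omega

theorem IsPolytope.dim_le_dim_add_ncard_diff (hP : IsPolytope d P) (hF : IsExposed ℝ P F)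
    (huF : u ∈ F) (hu : u ∈ vertices P) : d ≤ dim F + (nbrs P u \ F).ncard := by
  have h := hP.dim_le_dim_inter_add (IsExposed.refl P) huF (hF.subset huF) hu
  rw [Set.inter_eq_left.2 hF.subset, hP.2] at h
  refine h.trans (Nat.add_le_add_left (Set.ncard_le_ncard ?_ hP.finite_nbrs.sdiff) _)
  exact fun w hw => ⟨hw.1, hw.2.2⟩

theorem IsPolytope.add_dim_le_degree (hP : IsPolytope d P) (hF : IsExposed ℝ P F)
    (hG : IsExposed ℝ P G) (huF : u ∈ F) (huG : u ∈ G) (hu : u ∈ vertices P) :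
    dim F + dim G ≤ degree P u + dim (F ∩ G) := by
  have h1 := hP.dim_le_dim_inter_add hG huF huG hu
  have h2 := hP.ncard_nbrs_face_add hF huF
  have h3 := (hP.face hF ⟨u, huF⟩).le_ncard_nbrs (hP.mem_vertices_face hF hu huF)
  have h4 : (nbrs P u ∩ (G \ F)).ncard ≤ (nbrs P u \ F).ncard :=
    Set.ncard_le_ncard (fun w hw => ⟨hw.1, hw.2.2⟩) hP.finite_nbrs.sdiff
  rw [hP.degree_eq hu]
  omega

theorem IsPolytope.lt_ncard_vertices (hP : IsPolytope d P) : d < (vertices P).ncard := by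
  obtain ⟨u, hu⟩ := hP.vertices_nonempty
  have h1 := hP.le_ncard_nbrs hu
  refine h1.trans_lt (Set.ncard_lt_ncard ⟨hP.nbrs_subset_vertices, fun h => ?_⟩ hP.finite_vertices)
  exact (h hu).1 rfl

theorem IsPolytope.le_excess_of_facets (hP : IsPolytope d P) (hF : IsExposed ℝ P F)
    (hG : IsExposed ℝ P G) (huF : u ∈ F) (huG : u ∈ G) (hFd : dim F + 1 = d)
    (hGd : dim G + 1 = d) (hlt : dim (F ∩ G) + 3 ≤ d) : (d : ℤ) - 2 ≤ excess P := by
  have hK := hF.inter hG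
  have hKne : (F ∩ G).Nonempty := ⟨u, huF, huG⟩
  have hKp := hP.face hK hKne
  have hvK := hP.vertices_face hK hKne
  have hcard := hKp.lt_ncard_vertices
  rw [Set.ncard_eq_toFinset_card _ hKp.finite_vertices] at hcard
  have hsum := hP.sum_le_excess (s := hKp.finite_vertices.toFinset)
    (f := fun _ => (d : ℤ) - 2 - dim (F ∩ G))
    (fun v hv => by
      rw [Set.Finite.mem_toFinset, hvK] at hv
      exact hv.1)
    (fun v hv => by
      rw [Set.Finite.mem_toFinset, hvK] at hv
      have := hP.add_dim_le_degree hF hG hv.2.1 hv.2.2 hv.1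
      omega)
  rw [Finset.sum_const, nsmul_eq_mul] at hsum
  refine le_trans ?_ hsum
  have h1 : (dim (F ∩ G) : ℤ) + 1 ≤ (hKp.finite_vertices.toFinset.card : ℤ) := by exact_mod_cast hcard
  have h2 : (dim (F ∩ G) : ℤ) + 3 ≤ d := by exact_mod_cast hlt
  have h3 : (0 : ℤ) ≤ dim (F ∩ G) := Int.natCast_nonneg _
  -- With `k = dim (F ∩ G)`, this is `(k + 1) * (d - 2 - k) - (d - 2) = k * (d - 3 - k) ≥ 0`.
  nlinarith [mul_nonneg h3 (sub_nonneg.2 h2)]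

theorem IsPolytope.degree_le_of_nonsimple_facet (hP : IsPolytope d P) (hF : IsExposed ℝ P F)
    (hFd : dim F + 1 = d) (hex : (d : ℤ) - 3 ≤ excess F) (hlt : excess P < (d : ℤ) - 2)
    (hu : u ∈ vertices F) : degree P u ≤ degree F u + 1 := by
  by_contra! hdeg
  have hne : F.Nonempty := ⟨u, vertices_subset F hu⟩
  have hFp := hP.face hF hne
  have hvF := hP.vertices_face hF hne
  have hsum := hP.sum_le_excess (s := hFp.finite_vertices.toFinset)
    (f := fun v => (degree P v : ℤ) - d) (fun v hv => by
      rw [Set.Finite.mem_toFinset, hvF] at hv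
      exact hv.1) (fun v _ => le_rfl)
  -- Passing from `F` to `P` raises the subtracted dimension by one and each degree by at least one;
  -- at `u` the degree rises by at least two, hence strictness.
  have hlt' : excess F < ∑ v ∈ hFp.finite_vertices.toFinset, ((degree P v : ℤ) - d) := by
    rw [hFp.excess_eq_sum]
    refine Finset.sum_lt_sum (fun v hv => ?_) ⟨u, by simpa using hu, by omega⟩
    rw [Set.Finite.mem_toFinset] at hv
    have hv' := hv
    rw [hvF] at hv'
    have h1 := hP.ncard_nbrs_face_add hF hv'.2
    have h2 := hP.dim_le_dim_add_ncard_diff hF hv'.2 hv'.1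
    rw [hP.degree_eq hv'.1, hFp.degree_eq hv]
    omega
  omega

/-! ### Recognising simple vertices -/

theorem IsPolytope.ncard_nbrs_le_of_faces (hP : IsPolytope d P)
    (h : ∀ w ∈ nbrs P u, ∃ F, IsExposed ℝ P F ∧ u ∈ F ∧ w ∉ F ∧ nbrs P u \ {w} ⊆ F) :
    (nbrs P u).ncard ≤ d := by
  rcases (nbrs P u).eq_empty_or_nonempty with he | ⟨w₀, hw₀⟩
  · simp [he]
  obtain ⟨F₀, hF₀, huF₀, -⟩ := h w₀ hw₀
  have huP := hF₀.subset huF₀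
  have hli : LinearIndependent ℝ (fun w : nbrs P u => (w : E) - u) := by
    rw [linearIndependent_iff_notMem_span]
    rintro ⟨w, hw⟩ hmem
    obtain ⟨F, hF, huF, hwF, hsub⟩ := h w hw
    refine hwF (mem_of_sub_mem_vectorSpan hF huF (hP.nbrs_subset hw)
      ((Submodule.span_le.2 ?_ : _ ≤ vectorSpan ℝ F) hmem))
    rintro _ ⟨⟨z, hz⟩, ⟨-, hzw⟩, rfl⟩
    exact vsub_mem_vectorSpan ℝ (hsub ⟨hz, fun e => hzw (Subtype.ext e)⟩) huF
  have : Fintype (nbrs P u) := (hP.finite_nbrs (u := u)).fintype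
  rw [Set.ncard_eq_toFinset_card', Set.toFinset_card, ← finrank_span_eq_card hli, ← hP.2]
  refine Submodule.finrank_mono (Submodule.span_le.2 ?_)
  rintro _ ⟨⟨z, hz⟩, rfl⟩
  exact vsub_mem_vectorSpan ℝ (hP.nbrs_subset hz) huP

/-- Take a facet `G` containing the edge `ua` but not `w`. The ridge `F ∩ G` contains at least `d -
2` of the `d - 1` neighbours of `u` in `F`; as `w` is missing, it contains all the rest. -/
theorem IsPolytope.exists_facet_through_nbr (hP : IsPolytope d P) (hF : IsExposed ℝ P F)
    (hu : u ∈ vertices P) (huF : u ∈ F)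
    (hsimple : (nbrs F u).ncard + 1 = d)
    (hridge : ∀ G, IsExposed ℝ P G → u ∈ G → dim G + 1 = d → F ≠ G → dim (F ∩ G) + 2 = d)
    (ha : a ∈ nbrs P u) (haF : a ∉ F) (hw : w ∈ nbrs F u) :
    ∃ G, IsExposed ℝ P G ∧ u ∈ G ∧ a ∈ G ∧ w ∉ G ∧ ∀ z ∈ nbrs F u, z ≠ w → z ∈ G := by
  have hw' := hw
  rw [hP.nbrs_face hF huF] at hw'
  obtain ⟨G, hG, hsub, hwG, hGd⟩ := hP.exists_facet ha.2.2.1 ha.2.1 (hF.subset hw'.2)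
    (fun h => haF (hP.eq_of_mem_nbrs_of_mem_segment ha hw'.1 h ▸ hw'.2))
  rw [hP.2] at hGd
  have huG := hsub (left_mem_segment ℝ u a)
  refine ⟨G, hG, huG, hsub (right_mem_segment ℝ u a), hwG, fun z hz hzw => ?_⟩
  have hr := hridge G hG huG hGd fun h => hwG (h ▸ hw'.2)
  have hFG := hF.inter hG
  have hcard := (hP.face hFG ⟨u, huF, huG⟩).le_ncard_nbrs
    (hP.mem_vertices_face hFG hu ⟨huF, huG⟩)
  rw [hP.nbrs_face hFG ⟨huF, huG⟩] at hcard
  by_contra hzG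
  have hfin : (nbrs F u).Finite := (hP.face hF ⟨u, huF⟩).finite_nbrs
  have hle : (nbrs P u ∩ (F ∩ G)).ncard ≤ (nbrs F u \ {w, z}).ncard := by
    refine Set.ncard_le_ncard ?_ hfin.sdiff
    rintro v ⟨hv, hvF, hvG⟩
    rw [hP.nbrs_face hF huF]
    refine ⟨⟨hv, hvF⟩, ?_⟩
    rintro (rfl | rfl)
    · exact hwG hvG
    · exact hzG hvG
  have hpair : ({w, z} : Set E).ncard = 2 := Set.ncard_pair (Ne.symm hzw)
  have hsub2 : ({w, z} : Set E) ⊆ nbrs F u := by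
    rintro v (rfl | rfl)
    · exact hw
    · exact hz
  have := Set.ncard_sdiff_add_ncard_of_subset hsub2 hfin
  omega

/-- Write `b - u` as `α • (a - u)` plus a combination of the edge directions in `F`. Supporting
functionals of suitable facets through `a` and through `b` force each coefficient of the combination
to be both nonnegative and nonpositive, so `b` lies on the edge `ua`. -/
theorem IsPolytope.eq_of_simple_facet (hP : IsPolytope d P) (hF : IsExposed ℝ P F)
    (hFd : dim F + 1 = d) (hu : u ∈ vertices P) (huF : u ∈ F)
    (hsimple : (nbrs F u).ncard + 1 = d)
    (hridge : ∀ G, IsExposed ℝ P G → u ∈ G → dim G + 1 = d → F ≠ G → dim (F ∩ G) + 2 = d)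
    (ha : a ∈ nbrs P u) (haF : a ∉ F) (hb : b ∈ nbrs P u) (hbF : b ∉ F) : b = a := by
  have hFp := hP.face hF ⟨u, huF⟩
  have huP := hF.subset huF
  have haP := hP.nbrs_subset ha
  have hbP := hP.nbrs_subset hb
  have hspan : vectorSpan ℝ F ⊔ Submodule.span ℝ {a - u} = vectorSpan ℝ P := by
    have hlt : vectorSpan ℝ F < vectorSpan ℝ F ⊔ Submodule.span ℝ {a - u} := by
      refine lt_of_le_of_ne le_sup_left fun h => haF (mem_of_sub_mem_vectorSpan hF huF haP ?_)
      rw [h]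
      exact Submodule.mem_sup_right (Submodule.mem_span_singleton_self _)
    have h1 := Submodule.finrank_lt_finrank_of_lt hlt
    have h2 : Module.finrank ℝ (vectorSpan ℝ F) = dim F := rfl
    have h3 : Module.finrank ℝ (vectorSpan ℝ P) = d := hP.2
    refine Submodule.eq_of_le_of_finrank_le (sup_le (vectorSpan_mono ℝ hF.subset) ?_) (by omega)
    rw [Submodule.span_singleton_le_iff_mem]
    exact vsub_mem_vectorSpan ℝ haP huP
  have hbmem : b - u ∈ vectorSpan ℝ F ⊔ Submodule.span ℝ {a - u} :=
    hspan ▸ vsub_mem_vectorSpan ℝ hbP huP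
  obtain ⟨f, hf, g, hg, hfg⟩ := Submodule.mem_sup.1 hbmem
  obtain ⟨α, rfl⟩ := Submodule.mem_span_singleton.1 hg
  have hf' := hFp.vectorSpan_le_span_nbrs (hP.mem_vertices_face hF hu huF) hf
  have hfin : (nbrs F u).Finite := hFp.finite_nbrs
  rw [← hfin.coe_toFinset, Submodule.mem_span_image_finset_iff_exists_fun] at hf'
  obtain ⟨c, rfl⟩ : ∃ c : E → ℝ, ∑ z ∈ hfin.toFinset, c z • (z - u) = f := by
    obtain ⟨c, hc⟩ := hf'
    refine ⟨Function.extend Subtype.val c 0, ?_⟩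
    rw [← hc, ← Finset.sum_coe_sort]
    simp
  have hNP : ∀ z ∈ nbrs F u, z ∈ P := fun z hz => hF.subset (hFp.nbrs_subset hz)
  -- The functional of `F` kills the `F`-part and is strictly below its maximum at both `a` and `b`.
  have hα : 0 < α := by
    obtain ⟨l, hl, hlF⟩ := exists_functional hF huF
    have h1 : l (∑ z ∈ hfin.toFinset, c z • (z - u)) = 0 := by
      rw [map_sum]
      refine Finset.sum_eq_zero fun z hz => ?_
      have hz' := hfin.mem_toFinset.1 hz
      simp [(hlF z (hNP z hz')).1 (hFp.nbrs_subset hz')]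
    have h2 := congrArg l hfg
    rw [map_add, h1, zero_add, map_smul, map_sub, map_sub, smul_eq_mul] at h2
    have h3 := lt_of_le_of_ne (hl a haP) (mt (hlF a haP).2 haF)
    have h4 := lt_of_le_of_ne (hl b hbP) (mt (hlF b hbP).2 hbF)
    by_contra! h
    nlinarith
  have hc : ∀ w ∈ nbrs F u, c w = 0 := by
    intro w hw
    have key : ∀ G, IsExposed ℝ P G → u ∈ G → w ∉ G → (∀ z ∈ nbrs F u, z ≠ w → z ∈ G) →
        ∃ l : StrongDual ℝ E, (∀ y ∈ P, l y ≤ l u) ∧ (∀ y ∈ G, l y = l u) ∧ l w < l u ∧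
          c w * (l w - l u) + α * (l a - l u) = l b - l u := by
      intro G hG huG hwG hGN
      obtain ⟨l, hl, hlG⟩ := exists_functional hG huG
      refine ⟨l, hl, fun y hy => (hlG y (hG.subset hy)).1 hy,
        lt_of_le_of_ne (hl w (hNP w hw)) (mt (hlG w (hNP w hw)).2 hwG), ?_⟩
      have h1 : l (∑ z ∈ hfin.toFinset, c z • (z - u)) = c w * (l w - l u) := by
        rw [map_sum, Finset.sum_eq_single w]
        · simp
        · intro z hz hzw
          have hz' := hfin.mem_toFinset.1 hz
          simp [(hlG z (hNP z hz')).1 (hGN z hz' hzw)]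
        · exact fun h => absurd (hfin.mem_toFinset.2 hw) h
      have h2 := congrArg l hfg
      rwa [map_add, h1, map_smul, map_sub, map_sub, smul_eq_mul] at h2
    obtain ⟨G, hG, huG, haG, hwG, hGN⟩ :=
      hP.exists_facet_through_nbr hF hu huF hsimple hridge ha haF hw
    obtain ⟨G', hG', huG', hbG', hwG', hGN'⟩ :=
      hP.exists_facet_through_nbr hF hu huF hsimple hridge hb hbF hw
    obtain ⟨l, hl, hlG, hlw, hlc⟩ := key G hG huG hwG hGN
    obtain ⟨l', hl', hlG', hlw', hlc'⟩ := key G' hG' huG' hwG' hGN'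
    rw [hlG a haG] at hlc
    rw [hlG' b hbG'] at hlc'
    have h1 := hl b hbP
    have h2 := hl' a haP
    -- The facet through `b` gives `c w ≤ 0` (using `α > 0`), the one through `a` gives `0 ≤ c w`.
    refine le_antisymm ?_ ?_ <;> by_contra! h
    · nlinarith [mul_nonneg hα.le (sub_nonneg.2 h2), mul_pos h (sub_pos.2 hlw')]
    · nlinarith [mul_pos (neg_pos.2 h) (sub_pos.2 hlw)]
  refine hP.eq_of_mem_nbrs_of_mem_segment ha hb
    (mem_of_sub_mem_vectorSpan ha.2.2.1 (left_mem_segment ℝ u a) hbP ?_)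
  rw [← hfg, Finset.sum_eq_zero, zero_add]
  · exact Submodule.smul_mem _ _
      (vsub_mem_vectorSpan ℝ (right_mem_segment ℝ u a) (left_mem_segment ℝ u a))
  · intro z hz
    rw [hc z (hfin.mem_toFinset.1 hz), zero_smul]

/-! ### The excess of a nonsimple polytope -/

theorem IsPolytope.le_excess_of_not_isSimple (hP : IsPolytope d P) (hns : ¬ IsSimple P) :
    (d : ℤ) - 2 ≤ excess P := by
  induction d using Nat.strong_induction_on generalizing P with
  | _ d ih =>
    by_contra! hlt
    have h0 := hP.excess_nonneg
    simp only [IsSimple, not_forall] at hns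
    obtain ⟨u, hu, hdeg⟩ := hns
    rw [hP.2] at hdeg
    have hle := hP.le_degree hu
    rw [hP.degree_eq hu] at hdeg hle
    have hridge : ∀ F G, IsExposed ℝ P F → IsExposed ℝ P G → u ∈ F → u ∈ G → dim F + 1 = d →
        dim G + 1 = d → F ≠ G → dim (F ∩ G) + 2 = d := by
      intro F G hF hG huF huG hFd hGd hne
      have h1 : ¬ dim (F ∩ G) + 3 ≤ d := fun h =>
        absurd (hP.le_excess_of_facets hF hG huF huG hFd hGd h) (not_le.2 hlt)
      have h2 : dim (F ∩ G) < dim F := by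
        refine dim_lt_of_ssubset (hF.inter hG) ⟨u, huF, huG⟩ ⟨Set.inter_subset_left, fun h => ?_⟩
          hF.subset
        exact hne (eq_of_subset_of_dim_eq hF ⟨u, huF⟩ (fun y hy => (h hy).2) hG.subset (by omega))
      omega
    by_cases hs : ∃ F, IsExposed ℝ P F ∧ u ∈ F ∧ dim F + 1 = d ∧ (nbrs F u).ncard + 1 = d
    · obtain ⟨F, hF, huF, hFd, hsimple⟩ := hs
      have h1 := hP.ncard_nbrs_face_add hF huF
      have h2 : (nbrs P u \ F).ncard ≤ 1 := by
        rw [Set.ncard_le_one hP.finite_nbrs.sdiff]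
        rintro a ⟨ha, haF⟩ b ⟨hb, hbF⟩
        exact hP.eq_of_simple_facet hF hFd hu huF hsimple
          (fun G hG huG hGd hne => hridge F G hF hG huF huG hFd hGd hne) hb hbF ha haF
      omega
    · push Not at hs
      refine hdeg (le_antisymm (hP.ncard_nbrs_le_of_faces fun w hw => ?_) hle)
      obtain ⟨F, hF, huF, hwF, hFd⟩ := hP.exists_facet (isExposed_vertex hu)
        (Set.singleton_nonempty u) (hP.nbrs_subset hw) (by simpa using hw.1)
      rw [Set.singleton_subset_iff] at huF
      rw [hP.2] at hFd
      have hFp := hP.face hF ⟨u, huF⟩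
      have huF' := hP.mem_vertices_face hF hu huF
      have hnsF : ¬ IsSimple F := fun h => hs F hF huF hFd (by
        rw [← hFp.degree_eq huF', h u huF', hFd])
      have h1 := ih (dim F) (by omega) hFp hnsF
      have h2 := hP.degree_le_of_nonsimple_facet hF hFd (by omega) hlt huF'
      rw [hP.degree_eq hu, hFp.degree_eq huF'] at h2
      have h3 := hP.ncard_nbrs_face_add hF huF
      have h4 : (nbrs P u \ F).ncard ≤ 1 := by omega
      rw [Set.ncard_le_one hP.finite_nbrs.sdiff] at h4
      refine ⟨F, hF, huF, hwF, fun z hz => ?_⟩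
      by_contra hzF
      exact hz.2 (h4 z ⟨hz.1, hzF⟩ w ⟨hw, hwF⟩)

end LowerBound

/-! ### Polytopes attaining the two smallest values -/

section Examples

section Hull

variable {E : Type*} [NormedAddCommGroup E] [NormedSpace ℝ E] {P s : Set E} {d : ℕ} {u v w a b : E}

/-! ### Convex hulls of explicit finite sets -/

theorem isPolytope_convexHull (hs : s.Finite) (hne : s.Nonempty)
    (hd : Module.finrank ℝ (vectorSpan ℝ s) = d) : IsPolytope d (convexHull ℝ s) :=
  ⟨⟨s, hs, hne, rfl⟩, by rw [dim, vectorSpan_convexHull, hd]⟩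

theorem vertices_convexHull_subset (s : Set E) : vertices (convexHull ℝ s) ⊆ s :=
  exposedPoints_subset_extremePoints.trans extremePoints_convexHull_subset

theorem IsPolytope.degree_lt_ncard (hP : IsPolytope d P) (hs : s.Finite) (hsub : vertices P ⊆ s)
    (hu : u ∈ vertices P) : degree P u < s.ncard := by
  rw [hP.degree_eq hu]
  exact Set.ncard_lt_ncard ⟨hP.nbrs_subset_vertices.trans hsub, fun h => (h (hsub hu)).1 rfl⟩ hs

theorem IsPolytope.degree_add_one_lt_ncard (hP : IsPolytope d P) (hs : s.Finite)
    (hsub : vertices P ⊆ s) (hu : u ∈ vertices P) (hw : w ∈ s) (hwu : w ≠ u)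
    (hwn : w ∉ nbrs P u) : degree P u + 1 < s.ncard := by
  rw [hP.degree_eq hu, ← Set.ncard_insert_of_notMem hwn hP.finite_nbrs]
  refine Set.ncard_lt_ncard ⟨Set.insert_subset hw (hP.nbrs_subset_vertices.trans hsub), ?_⟩ hs
  intro h
  rcases h (hsub hu) with h | h
  · exact hwu h.symm
  · exact h.1 rfl

/-- Diagonals of a parallelogram are not edges: the segments `ab` and `vw` share a midpoint, so a
face `ab` would contain `v`, yet `f` vanishes on `ab` and not at `v`. -/
theorem notMem_nbrs_of_add_eq_add (hv : v ∈ P) (hw : w ∈ P)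
    (h : a + b = v + w) (f : E →ₗ[ℝ] ℝ) (ha : f a = 0) (hb : f b = 0) (hfv : f v ≠ 0) :
    b ∉ nbrs P a := by
  rintro ⟨-, he⟩
  have hmid : (1 / 2 : ℝ) • a + (1 / 2 : ℝ) • b ∈ segment ℝ a b :=
    ⟨1 / 2, 1 / 2, by norm_num, by norm_num, by norm_num, rfl⟩
  have hmid' : (1 / 2 : ℝ) • a + (1 / 2 : ℝ) • b ∈ openSegment ℝ v w :=
    ⟨1 / 2, 1 / 2, by norm_num, by norm_num, by norm_num, by rw [← smul_add, ← smul_add, h]⟩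
  obtain ⟨p, q, -, -, -, rfl⟩ := he.2.1.isExtreme.left_mem_of_mem_openSegment hv hw hmid hmid'
  simp [ha, hb] at hfv

theorem IsPolytope.mem_nbrs_of_functional (hP : IsPolytope d P) (hsub : vertices P ⊆ s) (hu : u ∈ P)
    (hv : v ∈ P) (hvu : v ≠ u) (l : StrongDual ℝ E) (hl : ∀ x ∈ s, l x ≤ l u) (hlv : l v = l u)
    (heq : ∀ x ∈ s, l x = l u → x = u ∨ x = v) : v ∈ nbrs P u := by
  have hle := hP.le_of_forall_vertices fun x hx => hl x (hsub hx)
  have hE := isExposed_of_functional l hu hle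
  have hne : {y ∈ P | l y = l u}.Nonempty := ⟨u, hu, rfl⟩
  have hseg : {y ∈ P | l y = l u} = segment ℝ u v := by
    refine Set.Subset.antisymm ?_ ((hE.convex hP.convex).segment_subset ⟨hu, rfl⟩ ⟨hv, hlv⟩)
    rw [(hP.face hE hne).eq_convexHull_vertices, hP.vertices_face hE hne, ← convexHull_pair]
    refine convexHull_mono ?_
    rintro x ⟨hx, -, hxl⟩
    exact heq x (hsub hx) hxl
  rw [hseg] at hE hne
  refine ⟨hvu, hne, hE, ?_⟩
  rw [dim, ← convexHull_pair, vectorSpan_convexHull, vectorSpan_pair_rev,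
    finrank_span_singleton (vsub_ne_zero.2 hvu)]

theorem IsPolytope.mem_vertices_of_mem_nbrs (hP : IsPolytope d P) (h : w ∈ nbrs P u) :
    u ∈ vertices P := by
  have hv := hP.vertices_segment h.1 h.2
  rw [hP.vertices_face h.2.2.1 h.2.1] at hv
  exact (hv.symm ▸ Set.mem_insert u {w} : u ∈ vertices P ∩ segment ℝ u w).1

end Hull

/-! ### The simplex and the iterated pyramid over a parallelogram -/

variable {ι : Type*} [DecidableEq ι] {d : ℕ}

/-- The `i`-th vertex of the standard simplex. -/
noncomputable def basisPt (i : ι) : EuclideanSpace ℝ ι := EuclideanSpace.single i (1 : ℝ)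

theorem basisPt_apply (i j : ι) : basisPt i j = if j = i then 1 else 0 := by
  simp [basisPt]

theorem basisPt_injective : Function.Injective (basisPt : ι → EuclideanSpace ℝ ι) := by
  intro i j h
  have := congrArg (fun x : EuclideanSpace ℝ ι => x i) h
  simpa [basisPt_apply] using this

/-- The vertices of the standard simplex together with the fourth vertex of the parallelogram
which has `i` and `j` as opposite vertices and `k` as a third vertex. -/
noncomputable def pyramidPts (i j k : ι) : Set (EuclideanSpace ℝ ι) :=
  insert (basisPt i + basisPt j - basisPt k) (Set.range basisPt)

theorem basisPt_mem_pyramidPts (i j k m : ι) : basisPt m ∈ pyramidPts i j k := Or.inr ⟨m, rfl⟩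

theorem apex_notMem_range_basisPt {i j k : ι} (hik : i ≠ k) (hjk : j ≠ k) :
    basisPt i + basisPt j - basisPt k ∉ Set.range (basisPt : ι → EuclideanSpace ℝ ι) := by
  rintro ⟨m, hm⟩
  have := congrArg (fun x : EuclideanSpace ℝ ι => x k) hm
  simp only [PiLp.sub_apply, PiLp.add_apply, basisPt_apply, if_neg hik.symm, if_neg hjk.symm,
    if_true] at this
  split_ifs at this <;> norm_num at this

variable [Fintype ι]

theorem finrank_vectorSpan_range_basisPt (h : Fintype.card ι = d + 1) :
    Module.finrank ℝ (vectorSpan ℝ (Set.range (basisPt : ι → EuclideanSpace ℝ ι))) = d :=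
  (EuclideanSpace.orthonormal_single (𝕜 := ℝ)
    (ι := ι)).linearIndependent.affineIndependent.finrank_vectorSpan h

theorem ncard_range_basisPt (h : Fintype.card ι = d + 1) :
    (Set.range (basisPt : ι → EuclideanSpace ℝ ι)).ncard = d + 1 := by
  rw [Set.ncard_range_of_injective basisPt_injective, Nat.card_eq_fintype_card, h]

theorem isPolytope_simplex (h : Fintype.card ι = d + 1) :
    IsPolytope d (convexHull ℝ (Set.range (basisPt : ι → EuclideanSpace ℝ ι))) := by
  have : Nonempty ι := Fintype.card_pos_iff.1 (by omega)
  exact isPolytope_convexHull (Set.finite_range _) (Set.range_nonempty _)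
    (finrank_vectorSpan_range_basisPt h)

theorem exists_isSimple (d : ℕ) :
    ∃ P : Set (EuclideanSpace ℝ (Fin (d + 1))), IsPolytope d P ∧ IsSimple P := by
  have hc : Fintype.card (Fin (d + 1)) = d + 1 := Fintype.card_fin _
  have hP := isPolytope_simplex hc
  refine ⟨_, hP, fun u hu => ?_⟩
  have h1 := hP.degree_lt_ncard (Set.finite_range _) (vertices_convexHull_subset _) hu
  rw [ncard_range_basisPt hc] at h1
  have h2 := hP.le_degree hu
  rw [hP.2]
  omega

theorem finite_pyramidPts (i j k : ι) : (pyramidPts i j k).Finite :=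
  (Set.finite_range _).insert _

theorem isPolytope_pyramid (h : Fintype.card ι = d + 1) (i j k : ι) :
    IsPolytope d (convexHull ℝ (pyramidPts i j k)) := by
  refine isPolytope_convexHull (finite_pyramidPts i j k) (Set.insert_nonempty _ _) ?_
  rw [pyramidPts, vectorSpan_insert_eq_vectorSpan, finrank_vectorSpan_range_basisPt h]
  have : basisPt i + basisPt j - basisPt k = (basisPt i -ᵥ basisPt k) +ᵥ basisPt j := by
    simp only [vsub_eq_sub, vadd_eq_add]
    abel
  rw [this]
  refine AffineSubspace.vadd_mem_of_mem_direction ?_ (subset_affineSpan ℝ _ ⟨j, rfl⟩)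
  rw [direction_affineSpan]
  exact vsub_mem_vectorSpan ℝ ⟨i, rfl⟩ ⟨k, rfl⟩

/-- The linear functional with given coefficients. -/
noncomputable def coeffDual (c : ι → ℝ) : StrongDual ℝ (EuclideanSpace ℝ ι) :=
  ∑ i, c i • EuclideanSpace.proj i

theorem coeffDual_basisPt (c : ι → ℝ) (i : ι) : coeffDual c (basisPt i) = c i := by
  simp [coeffDual, basisPt_apply]

theorem ncard_pyramidPts (h : Fintype.card ι = d + 1) {i j k : ι} (hik : i ≠ k) (hjk : j ≠ k) :
    (pyramidPts i j k).ncard = d + 2 := by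
  rw [pyramidPts, Set.ncard_insert_of_notMem (apex_notMem_range_basisPt hik hjk)
    (Set.finite_range _), ncard_range_basisPt h]

/-- Of the `d + 1` other points, the opposite corner of the parallelogram is not a neighbour.
Coordinate `k` separates the diagonal through `i` and `j` from the other corners; the difference of
coordinates `i` and `j` does so for the other diagonal. -/
theorem degree_pyramid_le_of_mem_base (h : Fintype.card ι = d + 1) {i j k : ι} (hij : i ≠ j)
    (hik : i ≠ k) (hjk : j ≠ k) {u : EuclideanSpace ℝ ι}
    (hu : u ∈ vertices (convexHull ℝ (pyramidPts i j k)))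
    (hbase : u ∈ ({basisPt i, basisPt j, basisPt k,
      basisPt i + basisPt j - basisPt k} : Set (EuclideanSpace ℝ ι))) :
    degree (convexHull ℝ (pyramidPts i j k)) u ≤ d := by
  have hP := isPolytope_pyramid h i j k
  have hmem := basisPt_mem_pyramidPts i j k
  have hq : basisPt i + basisPt j - basisPt k ∈ pyramidPts i j k := Or.inl rfl
  have hsub := subset_convexHull ℝ (pyramidPts i j k)
  have hne := apex_notMem_range_basisPt hik hjk
  have key : ∀ w ∈ pyramidPts i j k, w ≠ u → w ∉ nbrs (convexHull ℝ (pyramidPts i j k)) u →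
      degree (convexHull ℝ (pyramidPts i j k)) u ≤ d := by
    intro w hw hwu hwn
    have := hP.degree_add_one_lt_ncard (finite_pyramidPts i j k) (vertices_convexHull_subset _)
      hu hw hwu hwn
    rw [ncard_pyramidPts h hik hjk] at this
    omega
  rcases hbase with rfl | rfl | rfl | rfl
  · refine key _ (hmem j) (basisPt_injective.ne hij.symm)
      (notMem_nbrs_of_add_eq_add (hsub (hmem k)) (hsub hq) (by abel)
        (coeffDual (Pi.single k 1) : _ →ₗ[ℝ] ℝ) ?_ ?_ ?_) <;>
      simp [coeffDual_basisPt, hik, hjk]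
  · refine key _ (hmem i) (basisPt_injective.ne hij)
      (notMem_nbrs_of_add_eq_add (hsub (hmem k)) (hsub hq) (by abel)
        (coeffDual (Pi.single k 1) : _ →ₗ[ℝ] ℝ) ?_ ?_ ?_) <;>
      simp [coeffDual_basisPt, hik, hjk]
  · refine key _ hq (fun e => hne ⟨_, e.symm⟩)
      (notMem_nbrs_of_add_eq_add (hsub (hmem i)) (hsub (hmem j)) (by abel)
        (coeffDual (Pi.single i 1 - Pi.single j 1) : _ →ₗ[ℝ] ℝ) ?_ ?_ ?_) <;>
      simp [coeffDual_basisPt, hik.symm, hjk.symm, hij, hij.symm]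
  · refine key _ (hmem k) (fun e => hne ⟨_, e⟩)
      (notMem_nbrs_of_add_eq_add (hsub (hmem i)) (hsub (hmem j)) (by abel)
        (coeffDual (Pi.single i 1 - Pi.single j 1) : _ →ₗ[ℝ] ℝ) ?_ ?_ ?_) <;>
      simp [coeffDual_basisPt, hik.symm, hjk.symm, hij, hij.symm]

theorem excess_pyramid_le (h : Fintype.card ι = d + 1) {i j k : ι} (hij : i ≠ j)
    (hik : i ≠ k) (hjk : j ≠ k) :
    excess (convexHull ℝ (pyramidPts i j k)) ≤ (d : ℤ) - 2 := by
  classical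
  have hP := isPolytope_pyramid h i j k
  have hne := apex_notMem_range_basisPt hik hjk
  set T : Set (EuclideanSpace ℝ ι) :=
    {basisPt i, basisPt j, basisPt k, basisPt i + basisPt j - basisPt k} with hT
  have hTs : T ⊆ pyramidPts i j k := by
    rintro x (rfl | rfl | rfl | rfl)
    exacts [Or.inr ⟨_, rfl⟩, Or.inr ⟨_, rfl⟩, Or.inr ⟨_, rfl⟩, Or.inl rfl]
  have hTcard : T.ncard = 4 := by
    have hq : ∀ m, basisPt m ≠ basisPt i + basisPt j - basisPt k := fun m e => hne ⟨m, e⟩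
    rw [hT, Set.ncard_insert_of_notMem, Set.ncard_insert_of_notMem, Set.ncard_pair (hq k)]
    · rintro (e | e)
      exacts [hjk (basisPt_injective e), hq j e]
    · rintro (e | e | e)
      exacts [hij (basisPt_injective e), hik (basisPt_injective e), hq i e]
  have hcard := Set.ncard_sdiff_add_ncard_of_subset hTs (finite_pyramidPts i j k)
  rw [hTcard, ncard_pyramidPts h hik hjk] at hcard
  have hfin : (pyramidPts i j k \ T).Finite := (finite_pyramidPts i j k).sdiff
  rw [Set.ncard_eq_toFinset_card _ hfin] at hcard
  rw [hP.excess_eq_sum]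
  calc _ ≤ ∑ v ∈ hP.finite_vertices.toFinset, (if v ∈ hfin.toFinset then (1 : ℤ) else 0) := by
        refine Finset.sum_le_sum fun v hv => ?_
        rw [Set.Finite.mem_toFinset] at hv
        have hvs := vertices_convexHull_subset _ hv
        split_ifs with hvT
        · have := hP.degree_lt_ncard (finite_pyramidPts i j k) (vertices_convexHull_subset _) hv
          rw [ncard_pyramidPts h hik hjk] at this
          omega
        · have := degree_pyramid_le_of_mem_base h hij hik hjk hv
            (by by_contra hc; exact hvT (hfin.mem_toFinset.2 ⟨hvs, hc⟩))
          omega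
    _ ≤ (hfin.toFinset.card : ℤ) := by
        rw [Finset.sum_boole]
        exact_mod_cast Finset.card_le_card fun v hv => (Finset.mem_filter.1 hv).2
    _ = (d : ℤ) - 2 := by omega

theorem mem_nbrs_apex (h : Fintype.card ι = d + 1) {i j k m : ι}
    (him : i ≠ m) (hjm : j ≠ m) (hkm : k ≠ m) (hij : i ≠ j) (hik : i ≠ k) (hjk : j ≠ k)
    {v : EuclideanSpace ℝ ι} (hv : v ∈ pyramidPts i j k) (hvm : v ≠ basisPt m) :
    v ∈ nbrs (convexHull ℝ (pyramidPts i j k)) (basisPt m) := by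
  have hP := isPolytope_pyramid h i j k
  have hsub := subset_convexHull ℝ (pyramidPts i j k)
  have key : ∀ c : ι → ℝ, c m = 1 → coeffDual c v = 1 → (∀ n, c n ≤ 1) →
      (∀ n, c n = 1 → n = m ∨ basisPt n = v) → c i + c j - c k ≤ 1 →
      (c i + c j - c k = 1 → basisPt i + basisPt j - basisPt k = v) →
      v ∈ nbrs (convexHull ℝ (pyramidPts i j k)) (basisPt m) := by
    intro c hcm hcv hc hc' hq hq'
    refine hP.mem_nbrs_of_functional (vertices_convexHull_subset _) (hsub (Or.inr ⟨m, rfl⟩))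
      (hsub hv) hvm (coeffDual c) ?_ ?_ ?_
    · rintro _ (rfl | ⟨n, rfl⟩)
      · simpa [coeffDual_basisPt, hcm] using hq
      · simpa [coeffDual_basisPt, hcm] using hc n
    · rw [hcv, coeffDual_basisPt, hcm]
    · rintro _ (rfl | ⟨n, rfl⟩) e
      · exact Or.inr (hq' (by simpa [coeffDual_basisPt, hcm] using e))
      · rw [coeffDual_basisPt, coeffDual_basisPt, hcm] at e
        exact (hc' n e).imp_left (congrArg basisPt)
  rcases hv with rfl | ⟨n, rfl⟩
  -- The weight `-1` at `k` lifts the fourth corner to the value `1`, while all basis points other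
  -- than the apex get at most `0`.
  · refine key (fun n => if n = m then 1 else if n = k then -1 else 0) ?_ ?_ ?_ ?_ ?_ ?_
    · simp
    · simp [coeffDual_basisPt, him, hjm, hkm, hik, hjk]
    · intro n; split_ifs <;> norm_num
    · intro n; split_ifs with h1 <;> norm_num
      exact Or.inl h1
    · simp [him, hjm, hkm, hik, hjk]
    · simp
  · have hnm : n ≠ m := fun e => hvm (e ▸ rfl)
    -- When `n` is `i` or `j`, the weight `-1` on the opposite corner brings the fourth corner down
    -- from `1` to `0`.
    refine key (fun p => if p = m then 1 else if p = n then 1 else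
      if (n = i ∧ p = j) ∨ (n = j ∧ p = i) then -1 else 0) ?_ ?_ ?_ ?_ ?_ ?_
    · simp
    · simp [coeffDual_basisPt, hnm]
    · intro p; split_ifs <;> norm_num
    · intro p; split_ifs with h1 h2 <;> norm_num
      · exact Or.inl h1
      · exact Or.inr (h2 ▸ rfl)
    · rw [if_neg him, if_neg hjm, if_neg hkm]
      by_cases h1 : n = i
      · subst h1; simp [hij, hij.symm, hik.symm, hjk.symm]
      · by_cases h2 : n = j
        · subst h2; simp [hij, hij.symm, hik.symm, hjk.symm]
        · simp only [h1, h2, Ne.symm h1, Ne.symm h2, false_and, or_self, if_false]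
          split_ifs <;> norm_num
    · rw [if_neg him, if_neg hjm, if_neg hkm]
      by_cases h1 : n = i
      · subst h1; simp [hij, hij.symm, hik.symm, hjk.symm]
      · by_cases h2 : n = j
        · subst h2; simp [hij, hij.symm, hik.symm, hjk.symm]
        · simp only [h1, h2, Ne.symm h1, Ne.symm h2, false_and, or_self, if_false]
          split_ifs <;> norm_num

theorem not_isSimple_pyramid (h : Fintype.card ι = d + 1) {i j k m : ι}
    (him : i ≠ m) (hjm : j ≠ m) (hkm : k ≠ m) (hij : i ≠ j) (hik : i ≠ k) (hjk : j ≠ k) :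
    ¬ IsSimple (convexHull ℝ (pyramidPts i j k)) := by
  intro hs
  have hP := isPolytope_pyramid h i j k
  have hsub : pyramidPts i j k \ {basisPt m} ⊆
      nbrs (convexHull ℝ (pyramidPts i j k)) (basisPt m) := fun v hv =>
    mem_nbrs_apex h him hjm hkm hij hik hjk hv.1 hv.2
  have hm : basisPt m ∈ vertices (convexHull ℝ (pyramidPts i j k)) :=
    hP.mem_vertices_of_mem_nbrs (hsub ⟨Or.inr ⟨i, rfl⟩, fun e => him (basisPt_injective e)⟩)
  have hdeg := hs _ hm
  rw [hP.2, hP.degree_eq hm] at hdeg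
  have h1 := Set.ncard_le_ncard hsub hP.finite_nbrs
  have h2 := Set.ncard_sdiff_singleton_add_one (basisPt_mem_pyramidPts i j k m)
    (finite_pyramidPts i j k)
  rw [ncard_pyramidPts h hik hjk] at h2
  omega

theorem exists_excess_eq (hd : 3 ≤ d) :
    ∃ P : Set (EuclideanSpace ℝ (Fin (d + 1))), IsPolytope d P ∧ excess P = (d : ℤ) - 2 := by
  have hc : Fintype.card (Fin (d + 1)) = d + 1 := Fintype.card_fin _
  let i : Fin (d + 1) := ⟨0, by omega⟩
  let j : Fin (d + 1) := ⟨1, by omega⟩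
  let k : Fin (d + 1) := ⟨2, by omega⟩
  -- An index off the parallelogram, hence an apex; it exists because `d ≥ 3`.
  let m : Fin (d + 1) := ⟨3, by omega⟩
  have hij : i ≠ j := by simp [i, j]
  have hik : i ≠ k := by simp [i, k]
  have hjk : j ≠ k := by simp [j, k]
  have hP := isPolytope_pyramid hc i j k
  refine ⟨_, hP, le_antisymm (excess_pyramid_le hc hij hik hjk)
    (hP.le_excess_of_not_isSimple (not_isSimple_pyramid hc (m := m) ?_ ?_ ?_ hij hik hjk))⟩ <;>
  simp [i, j, k, m]

end Examples

end ConvexPolytope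

/-! ### The main theorem -/

theorem theorem3p3 (d : ℕ) (hd : 3 ≤ d) :
    (∀ (n : ℕ) (P : Set (EuclideanSpace ℝ (Fin n))), ConvexPolytope.IsPolytope d P →
      (ConvexPolytope.excess P = 0 ↔ ConvexPolytope.IsSimple P) ∧
      (¬ ConvexPolytope.IsSimple P → (d : ℤ) - 2 ≤ ConvexPolytope.excess P)) ∧
    IsLeast (ConvexPolytope.excessValues d) 0 ∧
    IsLeast (ConvexPolytope.excessValues d \ {0}) ((d : ℤ) - 2) := by
  refine ⟨fun n P hP => ⟨hP.excess_eq_zero_iff, hP.le_excess_of_not_isSimple⟩, ⟨?_, ?_⟩, ⟨?_, ?_⟩⟩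
  · obtain ⟨P, hP, hs⟩ := ConvexPolytope.exists_isSimple d
    exact ⟨_, P, hP, hP.excess_eq_zero_iff.2 hs⟩
  · rintro _ ⟨n, P, hP, rfl⟩
    exact hP.excess_nonneg
  · obtain ⟨P, hP, hx⟩ := ConvexPolytope.exists_excess_eq hd
    refine ⟨⟨_, P, hP, hx⟩, ?_⟩
    rw [Set.mem_singleton_iff]
    omega
  · rintro _ ⟨⟨n, P, hP, rfl⟩, hne⟩
    exact hP.le_excess_of_not_isSimple (mt hP.excess_eq_zero_iff.2 hne)
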